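/- **Setting.** Let $V,S$ be finite sets, and let $\Gamma=(G,\varphi)$ be an infinite game on an arena $G=(V,E)$, $V=V_0\mathrel{\dot\cup}V_1$, $\varphi\subseteq V^\omega$. Let $\Gamma'$ be a parity game on an arena with vertex set $S\times V$, edge relation $E'$ and colouring $c:S\times V\to\mathbb N$ (Player 0 wins a play iff the maximal colour seen infinitely often is even), and suppose that $\Gamma$ is simulated by $\Gamma'$ with initial memory content $s_0\in S$: (1) $(s,v)$ belongs to Player 0 iff $v\in V_0$; (2) if $(v,v')\in E$ then for every $s$ there is $s'$ with $((s,v),(s',v'))\in E'$; if $((s,v),(s_1,v_1)),((s,v),(s_2,v_2))\in E'$ then $s_1=s_2$; if $((s,v),(s',v'))\in E'$ then $(v,v')\in E$; (3) if $\varrho$ is a play of $\Gamma$ and $\varrho'$ is the play of $\Gamma'$ that starts in $(s_0,\varrho(0))$ and projects to $\varrho$, then $\varrho$ is won by Player 0 iff $\varrho'$ is. The *parity game automaton* $\mathcal A$ of $\Gamma'$ is the deterministic automaton over the alphabet $V$ with states $(S\times V)\mathrel{\dot\cup}\{q_0,q_{\rm sink}\}$, initial state $q_0$ and transitions $\delta(q_0,v')=(s_0,v')$,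 $\delta(q_{\rm sink},v')=q_{\rm sink}$, $\delta((s,v),v')=(s',v')$ if $((s,v),(s',v'))\in E'$, and $\delta((s,v),v')=q_{\rm sink}$ if $(v,v')\notin E$. Its states are coloured by $c$, with any colours for $q_0$ and $q_{\rm sink}$, and it accepts under the max-parity condition. Let $k$ be an even number at least as large as all colours, and recolour $\mathcal A$ by $c':=k-c$; from then on the min-parity condition is used (a run is accepting iff the minimal colour seen infinitely often is even). **Right-hand delayed simulation.** Let $\preceq$ be the order $0\prec2\prec4\prec\cdots\prec5\prec3\prec1$ on $\mathbb N$. Define $\pm(i,j,\checkmark)=\min\{i,j\}$ if $i\prec j$, and $\pm(i,j,\checkmark)=\checkmark$ otherwise. For $m\in\mathbb N$ put $\pm(i,j,m)=\min\{i,j,m\}$ if $i\prec j$. If $j\preceq i$, put $\pm(i,j,m)=m$ if $i$ is odd, $i\le m$, and ($j$ is odd or $m<j$); $\pm(i,j,m)=\checkmark$ if $j$ is even, $j\le m$, and ($i$ is even or $m<i$); $\pm(i,j,m)=\checkmark$ if $i$ is odd, $j$ is even and $i,j\le m$; and $\pm(i,j,m)=m$ in all other cases. The simulation game has positions $(p,q,m)$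 with $p,q\in S\times V$ and $m\in\mathbb N\cup\{\checkmark\}$, all belonging to Spoiler, and moves from $(p,q,m)$ to $(p',q',\pm(c'(p'),c'(q'),m))$ whenever $(p,p'),(q,q')\in E'$ and $p',q'$ have the same $V$-component. Duplicator wins an infinite play iff $\checkmark$ occurs in it infinitely often. Write $p\le^{rh}_{de}q$ if Duplicator has a winning strategy from $(p,q,m_0)$, where $m_0=\min\{c'(p),c'(q)\}$ if $c'(p)\prec c'(q)$ and $m_0=\checkmark$ otherwise. For $p,q$ **with the same $V$-component**, write $p\approx^{rh}_{de}q$ if $p\le^{rh}_{de}q$ and $q\le^{rh}_{de}p$. **Quotient.** Let $s_1\approx_S s_2$ iff $(s_1,v)\approx^{rh}_{de}(s_2,v)$ for all $v\in V$, and fix a total order on $S$. The quotient automaton $\mathcal A/_{\approx_S}$ has states $(S/_{\approx_S}\times V)\mathrel{\dot\cup}\{q_0,q_{\rm sink}\}$, initial state $q_0$, and transitions $q_0\mapsto([s_0],v')$ and $q_{\rm sink}\mapsto q_{\rm sink}$ on letter $v'$; on $v'$ the state $([s],v)$ goes to $([s_{\min}],v')$ with $s_{\min}=\min\{\hat s'\mid\exists\hat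 s\approx_S s:\ \delta((\hat s,v),v')=(\hat s',v')\}$ if $(v,v')\in E$, and to $q_{\rm sink}$ otherwise. It is coloured by $c'/_{\approx_S}([s],v)=\min\{c'(s',v)\mid(s',v)\approx^{rh}_{de}(s,v)\}$, while $q_0,q_{\rm sink}$ keep their colours under $c'$, and it accepts under the min-parity condition. **Lemma.** $\mathcal A$ and $\mathcal A/_{\approx_S}$ accept the same $\omega$-language: $L(\mathcal A)=L(\mathcal A/_{\approx_S})$. Here $L(\mathcal A)$ is the language of $\mathcal A$ under the max-parity condition for $c$, which is also its language under the min-parity condition for $c'$. -/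

import Mathlib

namespace GameReduction

/-! ### Infinite games -/

/-- A game arena: a directed graph whose vertices are partitioned into the vertices `owner0` of
Player 0 and the remaining vertices, which belong to Player 1. -/
structure Arena (V : Type*) where
  owner0 : Set V
  edge : V → V → Prop

/-- A play is an infinite path through the arena. -/
def Arena.IsPlay {V : Type*} (G : Arena V) (ρ : ℕ → V) : Prop :=
  ∀ i, G.edge (ρ i) (ρ (i + 1))

/-- An infinite game: an arena together with the set of plays that are won by Player 0. -/
structure InfiniteGame (V : Type*) extends Arena V where
  win : Set (ℕ → V)

/-- The nonempty finite word `w ++ [v]` is the history that ends in `v`.  A strategy of Player 0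
is a function `f` on histories; only its values on histories that end in a vertex of Player 0
matter, and there it has to move along an edge. -/
def Arena.IsStrategy {V : Type*} (G : Arena V) (f : List V → V) : Prop :=
  ∀ (w : List V) (v : V), (w ++ [v]).IsChain G.edge → v ∈ G.owner0 → G.edge v (f (w ++ [v]))

/-- The play `ρ` is played according to the strategy `f` of Player 0. -/
def Arena.IsPlayedAccordingTo {V : Type*} (G : Arena V) (f : List V → V) (ρ : ℕ → V) : Prop :=
  ∀ i, ρ i ∈ G.owner0 → ρ (i + 1) = f (List.ofFn fun j : Fin (i + 1) => ρ j)

/-- Player 0 has a winning strategy from the vertex `x`. -/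
def InfiniteGame.HasWinningStrategy {V : Type*} (Γ : InfiniteGame V) (x : V) : Prop :=
  ∃ f : List V → V, Γ.IsStrategy f ∧
    ∀ ρ : ℕ → V, Γ.IsPlay ρ → ρ 0 = x → Γ.IsPlayedAccordingTo f ρ → ρ ∈ Γ.win

/-! ### Parity conditions -/

/-- The colours that occur infinitely often in a sequence of colours. -/
def infColours (x : ℕ → ℕ) : Set ℕ := {m | ∃ᶠ n in Filter.atTop, x n = m}

/-- The maximal colour seen infinitely often exists and is even. -/
def MaxParity (x : ℕ → ℕ) : Prop := ∃ m, IsGreatest (infColours x) m ∧ Even m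

/-- The minimal colour seen infinitely often exists and is even. -/
def MinParity (x : ℕ → ℕ) : Prop := ∃ m, IsLeast (infColours x) m ∧ Even m

/-- A (max-)parity game: an arena with a colouring of its vertices. -/
structure ParityGame (V : Type*) extends Arena V where
  colour : V → ℕ

/-- A parity game as an infinite game: Player 0 wins the plays on which the maximal colour seen
infinitely often is even. -/
def ParityGame.toInfiniteGame {V : Type*} (Γ : ParityGame V) : InfiniteGame V where
  toArena := Γ.toArena
  win := {ρ | Γ.IsPlay ρ ∧ MaxParity fun i => Γ.colour (ρ i)}

/-! ### Game simulation -/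

/-- `Γ` is simulated by the game `Γ'` with memory set `S` and initial memory content `s₀`. -/
structure InfiniteGame.SimulatedBy {V S : Type*} (Γ : InfiniteGame V)
    (Γ' : InfiniteGame (S × V)) (s₀ : S) : Prop where
  owner_iff : ∀ s v, (s, v) ∈ Γ'.owner0 ↔ v ∈ Γ.owner0
  exists_edge : ∀ s v v', Γ.edge v v' → ∃ s', Γ'.edge (s, v) (s', v')
  memory_unique : ∀ s v s₁ v₁ s₂ v₂,
    Γ'.edge (s, v) (s₁, v₁) → Γ'.edge (s, v) (s₂, v₂) → s₁ = s₂
  edge_proj : ∀ s v s' v', Γ'.edge (s, v) (s', v') → Γ.edge v v'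
  win_iff : ∀ (ρ : ℕ → V) (ρ' : ℕ → S × V), Γ.IsPlay ρ → Γ'.IsPlay ρ' →
    ρ' 0 = (s₀, ρ 0) → (∀ i, (ρ' i).2 = ρ i) → (ρ ∈ Γ.win ↔ ρ' ∈ Γ'.win)

/-! ### Game automata -/

/-- The state set `(M × V) ∪ {q₀, q_sink}`. -/
inductive AutState (M V : Type*)
  | init : AutState M V
  | sink : AutState M V
  | pair : M → V → AutState M V

/-- The action of a map of memory sets on states. -/
def AutState.mapMemory {M N V : Type*} (f : M → N) : AutState M V → AutState N V
  | .init => .init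
  | .sink => .sink
  | .pair s v => .pair (f s) v

/-- A deterministic automaton over the alphabet `V` with state set `(M × V) ∪ {q₀, q_sink}` and
initial state `q₀`, a colouring of its states, and the set `V₀` of vertices of Player 0. -/
structure ColouredAutomaton (M V : Type*) where
  step : AutState M V → V → AutState M V
  colour : AutState M V → ℕ
  owner0 : Set V

namespace ColouredAutomaton

variable {M V : Type*}

/-- The unique run on the infinite word `α`. -/
def run (A : ColouredAutomaton M V) (α : ℕ → V) : ℕ → AutState M V
  | 0 => .init
  | n + 1 => A.step (A.run α n) (α n)

/-- The language accepted under the max-parity condition. -/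
def maxLanguage (A : ColouredAutomaton M V) : Set (ℕ → V) :=
  {α | MaxParity fun n => A.colour (A.run α n)}

/-- The language accepted under the min-parity condition. -/
def minLanguage (A : ColouredAutomaton M V) : Set (ℕ → V) :=
  {α | MinParity fun n => A.colour (A.run α n)}

/-- The automaton with every colour `c` replaced by `k - c` (used for `k` at least as large as
all colours, so that the subtraction does not truncate). -/
def recolour (A : ColouredAutomaton M V) (k : ℕ) : ColouredAutomaton M V where
  step := A.step
  colour q := k - A.colour q
  owner0 := A.owner0

end ColouredAutomaton

open Classical in
/-- The transition function of the game automaton of a game on `S × V` with edge relation `E'`: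
transitions are labelled by the `V`-component of their target, and a letter for which there is no
edge leads to the sink. -/
noncomputable def gameStep {S V : Type*} (E' : S × V → S × V → Prop) (s₀ : S) :
    AutState S V → V → AutState S V
  | .init, v' => .pair s₀ v'
  | .sink, _ => .sink
  | .pair s v, v' => if h : ∃ s', E' (s, v) (s', v') then .pair h.choose v' else .sink

/-- The colouring of `S × V` extended by a colour `c₀` of `q₀` and a colour `cs` of the sink. -/
def gameColour {S V : Type*} (c : S × V → ℕ) (c₀ cs : ℕ) : AutState S V → ℕ
  | .init => c₀
  | .sink => cs
  | .pair s v => c (s, v)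

/-- The parity game automaton of the parity game `Γ'` on `S × V`.  The colours `c₀` and `cs` of
`q₀` and the sink are free; runs into the sink are rejecting exactly if `cs` is odd. -/
noncomputable def gameAutomaton {S V : Type*} (G : Arena V) (Γ' : ParityGame (S × V)) (s₀ : S)
    (c₀ cs : ℕ) : ColouredAutomaton S V where
  step := gameStep Γ'.edge s₀
  colour := gameColour Γ'.colour c₀ cs
  owner0 := G.owner0

/-! ### Right-hand delayed simulation -/

/-- The reward order `0 ≺ 2 ≺ 4 ≺ … ≺ 5 ≺ 3 ≺ 1` on the natural numbers. -/
def RewardLE (m n : ℕ) : Prop :=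
  (Even m ∧ Odd n) ∨ (Even m ∧ Even n ∧ m ≤ n) ∨ (Odd m ∧ Odd n ∧ n ≤ m)

/-- The strict reward order: `m` is better than `n`. -/
def RewardLT (m n : ℕ) : Prop := RewardLE m n ∧ m ≠ n

open Classical in
/-- The update function of the priority memory; `none` stands for the check mark `✓`. -/
noncomputable def pmUpdate (i j : ℕ) : Option ℕ → Option ℕ
  | none => if RewardLT i j then some (min i j) else none
  | some k =>
    if RewardLT i j then some (min (min i j) k)
    else if RewardLE j i ∧ Odd i ∧ i ≤ k ∧ (Odd j ∨ k < j) then some k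
    else if RewardLE j i ∧ Even j ∧ j ≤ k ∧ (Even i ∨ k < i) then none
    else if Odd i ∧ Even j ∧ i ≤ k ∧ j ≤ k then none
    else some k

namespace ColouredAutomaton

variable {S V : Type*}

/-- The colour of the state `(s, v)`. -/
def pairColour (A : ColouredAutomaton S V) (p : S × V) : ℕ := A.colour (.pair p.1 p.2)

/-- The right-hand delayed simulation game.  All vertices belong to Spoiler; Duplicator is
Player 0 and owns none.  She wins iff the priority memory is `✓` infinitely often. -/
noncomputable def simGame (A : ColouredAutomaton S V) :
    InfiniteGame ((S × V) × (S × V) × Option ℕ) where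
  owner0 := ∅
  edge x y :=
    A.step (.pair x.1.1 x.1.2) y.1.2 = .pair y.1.1 y.1.2 ∧
    A.step (.pair x.2.1.1 x.2.1.2) y.2.1.2 = .pair y.2.1.1 y.2.1.2 ∧
    y.1.2 = y.2.1.2 ∧
    y.2.2 = pmUpdate (A.pairColour y.1) (A.pairColour y.2.1) x.2.2
  win := {ρ | ∃ᶠ n in Filter.atTop, (ρ n).2.2 = none}

open Classical in
/-- The initial position of the simulation game for a pair of states. -/
noncomputable def simInit (A : ColouredAutomaton S V) (p q : S × V) :
    (S × V) × (S × V) × Option ℕ :=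
  (p, q, if RewardLT (A.pairColour p) (A.pairColour q)
    then some (min (A.pairColour p) (A.pairColour q)) else none)

/-- `q` right-hand delayed simulates `p`. -/
def RhLE (A : ColouredAutomaton S V) (p q : S × V) : Prop :=
  A.simGame.HasWinningStrategy (A.simInit p q)

/-- Right-hand delayed simulation equivalence, considered for states with the same
`V`-component. -/
def RhEquiv (A : ColouredAutomaton S V) (p q : S × V) : Prop :=
  p.2 = q.2 ∧ A.RhLE p q ∧ A.RhLE q p

/-! ### The quotient automaton -/

/-- The induced equivalence of memory contents. -/
def MemEquiv (A : ColouredAutomaton S V) (s₁ s₂ : S) : Prop :=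
  ∀ v : V, A.RhEquiv (s₁, v) (s₂, v)

/-- The set of equivalence classes of memory contents. -/
def MemQuot (A : ColouredAutomaton S V) : Type _ := Quot A.MemEquiv

/-- The class `[s]` of the memory content `s`. -/
def memClass (A : ColouredAutomaton S V) (s : S) : A.MemQuot := Quot.mk A.MemEquiv s

/-- The memory contents that are reached on the letter `v'` from some state `(t, v)` with `t` in
the class `C`. -/
def succMemory (A : ColouredAutomaton S V) (C : A.MemQuot) (v v' : V) : Set S :=
  {s' | ∃ t : S, A.memClass t = C ∧ A.step (.pair t v) v' = .pair s' v'}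

open Classical in
/-- The transition function of the quotient automaton: the `v'`-successor of `(C, v)` is
`([s_min], v')` for the least element `s_min` of `succMemory C v v'` in the fixed total order on
`S`, and the sink if there is no successor. -/
noncomputable def quotStep [LinearOrder S] [Finite S] (A : ColouredAutomaton S V) :
    AutState A.MemQuot V → V → AutState A.MemQuot V
  | .init, v' => (A.step .init v').mapMemory A.memClass
  | .sink, v' => (A.step .sink v').mapMemory A.memClass
  | .pair C v, v' =>
    if h : (A.succMemory C v v').Nonempty then
      .pair (A.memClass (wellFounded_lt.min (A.succMemory C v v') h)) v'
    else .sink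

/-- The colouring of the quotient automaton: the minimal colour over the
right-hand-delayed-simulation class; `q₀` and the sink keep their colours. -/
noncomputable def quotColour (A : ColouredAutomaton S V) : AutState A.MemQuot V → ℕ
  | .init => A.colour .init
  | .sink => A.colour .sink
  | .pair C v => sInf {c | ∃ (s : S) (p : S × V),
      A.memClass s = C ∧ A.RhEquiv p (s, v) ∧ c = A.pairColour p}

/-- The quotient automaton with respect to the equivalence of memory contents. -/
noncomputable def quotient [LinearOrder S] [Finite S] (A : ColouredAutomaton S V) :
    ColouredAutomaton A.MemQuot V where
  step := A.quotStep
  colour := A.quotColour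
  owner0 := A.owner0

end ColouredAutomaton

end GameReduction

namespace GameReduction

open Filter

/-! ### Parity conditions on bounded sequences -/

/-! Duplicator has no choices, so `p ≤ q` says that ✓ recurs for every pair of paths from `p` and
`q` reading the same letters. `frequently_memorySeq_eq_none_iff` removes the memory: ✓ recurs iff
the colour sequences satisfy `Dominates`. This condition is transitive and passes to tails, so
equivalence is transitive and propagates along common letters. Hence the quotient run stays in the
classes visited by the run of the automaton (`QuotRel.step`), and its colours are the class minima
along that run.

Passing to class minima does not change the parity outcome (`IsPath.minParity_iff`). Take a path `Q`
from a colour-minimal state equivalent to `P n`, reading the same letters as `P`. If the minimum is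
even, `P` later shows a colour at most as large; if it is odd and below the colour of `P n`, `Q`
later shows a smaller colour, which bounds a later class minimum. So both sequences have the same
limit inferior. -/

theorem isLeast_infColours {x : ℕ → ℕ} {e : ℕ} (h₁ : ∃ᶠ n in atTop, x n ≤ e)
    (h₂ : ∀ᶠ n in atTop, e ≤ x n) : IsLeast (infColours x) e := by
  constructor
  · exact (h₁.and_eventually h₂).mono fun n hn => le_antisymm hn.1 hn.2
  · intro m hm
    obtain ⟨n, hn, hn'⟩ := (Frequently.and_eventually hm h₂).exists
    omega

theorem exists_limitInf {x : ℕ → ℕ} {k : ℕ} (hx : ∀ n, x n ≤ k) :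
    ∃ e, (∃ᶠ n in atTop, x n ≤ e) ∧ ∀ᶠ n in atTop, e ≤ x n := by
  classical
  have hex : ∃ e, ∃ᶠ n in atTop, x n ≤ e := ⟨k, (Eventually.of_forall hx).frequently⟩
  refine ⟨Nat.find hex, Nat.find_spec hex, ?_⟩
  rcases Nat.eq_zero_or_pos (Nat.find hex) with h0 | hpos
  · exact Eventually.of_forall fun n => by omega
  · have := Nat.find_min hex (Nat.sub_lt hpos one_pos)
    rw [not_frequently] at this
    exact this.mono fun n hn => by omega

theorem minParity_iff_even {x : ℕ → ℕ} {e : ℕ} (h₁ : ∃ᶠ n in atTop, x n ≤ e)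
    (h₂ : ∀ᶠ n in atTop, e ≤ x n) : MinParity x ↔ Even e := by
  have h := isLeast_infColours h₁ h₂
  exact ⟨fun ⟨m, hm, hev⟩ => hm.unique h ▸ hev, fun hev => ⟨e, h, hev⟩⟩

theorem infColours_congr {x y : ℕ → ℕ} (h : x =ᶠ[atTop] y) : infColours x = infColours y := by
  ext m
  exact frequently_congr (h.mono fun n hn => by rw [hn])

theorem infColours_shift (x : ℕ → ℕ) : infColours (fun n => x (n + 1)) = infColours x := by
  ext m
  change (∃ᶠ n in atTop, x (n + 1) = m) ↔ ∃ᶠ n in atTop, x n = m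
  simp only [frequently_atTop]
  constructor
  · intro h a
    obtain ⟨b, hb, hx⟩ := h a
    exact ⟨b + 1, by omega, hx⟩
  · intro h a
    obtain ⟨b, hb, hx⟩ := h (a + 1)
    exact ⟨b - 1, by omega, by rwa [Nat.sub_add_cancel (by omega)]⟩

theorem minParity_congr {x y : ℕ → ℕ} (h : x =ᶠ[atTop] y) : MinParity x ↔ MinParity y := by
  unfold MinParity
  rw [infColours_congr h]

theorem minParity_shift (x : ℕ → ℕ) : MinParity (fun n => x (n + 1)) ↔ MinParity x := by
  unfold MinParity
  rw [infColours_shift x]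

/-- On colours up to `k`, the reflection `m ↦ k - m` is an order-reversing involution, and it
preserves parity because `k` is even. -/
theorem maxParity_iff_minParity_sub {x : ℕ → ℕ} {k : ℕ} (hk : Even k) (hx : ∀ n, x n ≤ k) :
    MaxParity x ↔ MinParity fun n => k - x n := by
  have hle : ∀ m ∈ infColours x, m ≤ k := fun m hm => by
    obtain ⟨n, hn⟩ := Frequently.exists hm
    exact hn ▸ hx n
  have hle' : ∀ m ∈ infColours (fun n => k - x n), m ≤ k := fun m hm => by
    obtain ⟨n, hn⟩ := Frequently.exists hm
    exact hn ▸ Nat.sub_le _ _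
  have hto : ∀ m ∈ infColours x, k - m ∈ infColours fun n => k - x n := fun m hm =>
    Frequently.mono hm fun n hn => by simp only [hn]
  have hfrom : ∀ m ∈ infColours (fun n => k - x n), k - m ∈ infColours x := fun m hm =>
    Frequently.mono hm fun n hn => by have := hx n; simp only at hn; omega
  constructor
  · rintro ⟨m, ⟨hm, hub⟩, hev⟩
    refine ⟨k - m, ⟨hto m hm, fun a ha => ?_⟩, hk.tsub hev⟩
    have := hub (hfrom a ha)
    omega
  · rintro ⟨m, ⟨hm, hlb⟩, hev⟩
    refine ⟨k - m, ⟨hfrom m hm, fun a ha => ?_⟩, hk.tsub hev⟩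
    have := hlb (hto a ha)
    have := hle a ha
    have := hle' m hm
    omega

/-- Lowering colours preserves the min-parity condition, provided that an odd lowered colour is
always followed by a smaller one and an even lowered colour by an original one of at most the
same size. -/
theorem minParity_iff_of_lowered {x y : ℕ → ℕ} {k : ℕ} (hx : ∀ n, x n ≤ k) (hyx : ∀ n, y n ≤ x n)
    (hodd : ∀ n, Odd (y n) → y n < x n → ∃ n' ≥ n, y n' < y n)
    (heven : ∀ n, Even (y n) → ∃ n' ≥ n, x n' ≤ y n) : MinParity x ↔ MinParity y := by
  obtain ⟨e, he₁, he₂⟩ := exists_limitInf hx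
  obtain ⟨d, hd₁, hd₂⟩ := exists_limitInf fun n => (hyx n).trans (hx n)
  have hde : d ≤ e := by
    obtain ⟨n, hn, hn'⟩ := (he₁.and_eventually hd₂).exists
    exact hn'.trans ((hyx n).trans hn)
  have hed : e ≤ d := by
    -- Far out, `y ≥ d` and `x ≥ e > d`. Where `y` attains `d` the colour was truly lowered, and
    -- either parity then yields a later value below one of these bounds.
    by_contra! hlt
    obtain ⟨N, hN⟩ := eventually_atTop.1 (hd₂.and he₂)
    obtain ⟨n, hn, hyn⟩ := frequently_atTop.1 hd₁ N
    have hy : y n = d := le_antisymm hyn (hN n hn).1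
    rcases Nat.even_or_odd (y n) with hev | hod
    · obtain ⟨n', hn', hle⟩ := heven n hev
      have := (hN n' (hn.trans hn')).2
      omega
    · obtain ⟨n', hn', hle⟩ := hodd n hod (by have := (hN n hn).2; omega)
      have := (hN n' (hn.trans hn')).1
      omega
  obtain rfl := le_antisymm hde hed
  rw [minParity_iff_even he₁ he₂, minParity_iff_even hd₁ hd₂]

/-! ### The priority memory -/

/-- The smaller of the two colours decides, by its parity and by whose it is. -/
theorem rewardLT_iff (i j : ℕ) : RewardLT i j ↔ (Even i ∧ i < j) ∨ (Odd j ∧ j < i) := by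
  unfold RewardLT RewardLE
  simp only [Nat.even_iff, Nat.odd_iff]
  omega

theorem rewardLE_of_not_rewardLT {i j : ℕ} (h : ¬RewardLT i j) : RewardLE j i := by
  rw [rewardLT_iff] at h
  unfold RewardLE
  simp only [Nat.even_iff, Nat.odd_iff] at h ⊢
  omega

open Classical in
-- Once `j ⪯ i`, the colour `i` is irrelevant: the two ✓ cases together cover exactly `j` even with
-- `j ≤ m`.
theorem pmUpdate_some (i j m : ℕ) : pmUpdate i j (some m) =
    if RewardLT i j then some (min (min i j) m) else if Even j ∧ j ≤ m then none else some m := by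
  unfold pmUpdate
  by_cases h : RewardLT i j
  · simp [h]
  · have hle := rewardLE_of_not_rewardLT h
    simp only [h, hle, if_false, true_and, Nat.even_iff, Nat.odd_iff]
    split_ifs <;> first | rfl | omega

/-- The colour sequence `j` answers the colour sequence `i` in the sense of right-hand delayed
simulation: even colours of `i` are eventually matched by even colours of `j`, and odd colours
of `j` that are smaller than those of `i` are eventually undercut. -/
def Dominates (i j : ℕ → ℕ) : Prop :=
  (∀ n, Even (i n) → ∃ n' ≥ n, Even (j n') ∧ j n' ≤ i n) ∧
  (∀ n, Odd (j n) → j n < i n → ∃ n' ≥ n, Even (j n') ∧ j n' < j n)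

theorem Dominates.refl (i : ℕ → ℕ) : Dominates i i :=
  ⟨fun n h => ⟨n, le_rfl, h, le_rfl⟩, fun _ _ h => absurd h (lt_irrefl _)⟩

theorem Dominates.trans {i j l : ℕ → ℕ} (hij : Dominates i j) (hjl : Dominates j l) :
    Dominates i l := by
  refine ⟨fun n hn => ?_, fun n hn hlt => ?_⟩
  · obtain ⟨a, ha, hev, hle⟩ := hij.1 n hn
    obtain ⟨b, hb, hev', hle'⟩ := hjl.1 a hev
    exact ⟨b, ha.trans hb, hev', hle'.trans hle⟩
  · rcases lt_or_ge (l n) (j n) with h | h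
    · exact hjl.2 n hn h
    -- Here `j n ≤ l n < i n`. An even `j n` is answered by an even colour of `l`, which is strictly
    -- below the odd `l n`; an odd `j n` is first undercut within `j`.
    · rcases Nat.even_or_odd (j n) with hev | hod
      · obtain ⟨b, hb, hev', hle⟩ := hjl.1 n hev
        exact ⟨b, hb, hev', by rw [Nat.even_iff] at *; rw [Nat.odd_iff] at *; omega⟩
      · obtain ⟨a, ha, hev, hle⟩ := hij.2 n hod (h.trans_lt hlt)
        obtain ⟨b, hb, hev', hle'⟩ := hjl.1 a hev
        exact ⟨b, ha.trans hb, hev', by omega⟩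

theorem Dominates.tail {i j : ℕ → ℕ} (h : Dominates i j) :
    Dominates (fun n => i (n + 1)) fun n => j (n + 1) := by
  refine ⟨fun n hn => ?_, fun n hn hlt => ?_⟩
  · obtain ⟨a, ha, hev⟩ := h.1 (n + 1) hn
    exact ⟨a - 1, by omega, by simpa only [Nat.sub_add_cancel (show 1 ≤ a by omega)] using hev⟩
  · obtain ⟨a, ha, hev⟩ := h.2 (n + 1) hn hlt
    exact ⟨a - 1, by omega, by simpa only [Nat.sub_add_cancel (show 1 ≤ a by omega)] using hev⟩

theorem Dominates.exists_repay {i j : ℕ → ℕ} (h : Dominates i j) {n : ℕ}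
    (hlt : RewardLT (i n) (j n)) : ∃ n' > n, Even (j n') ∧ j n' ≤ min (i n) (j n) := by
  rw [rewardLT_iff] at hlt
  rcases hlt with ⟨hev, hlt⟩ | ⟨hod, hlt⟩
  · obtain ⟨a, ha, hev', hle⟩ := h.1 n hev
    exact ⟨a, lt_of_le_of_ne ha (by rintro rfl; omega), hev', by omega⟩
  · obtain ⟨a, ha, hev', hle⟩ := h.2 n hod hlt
    exact ⟨a, lt_of_le_of_ne ha (by rintro rfl; omega), hev', by omega⟩

/-- The values of the priority memory along the colour sequences `i` and `j`. -/
noncomputable def memorySeq (i j : ℕ → ℕ) : ℕ → Option ℕ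
  | 0 => pmUpdate (i 0) (j 0) none
  | n + 1 => pmUpdate (i (n + 1)) (j (n + 1)) (memorySeq i j n)

theorem memorySeq_eq_some_of_rewardLT {i j : ℕ → ℕ} {n : ℕ} (h : RewardLT (i n) (j n)) :
    ∃ a ≤ min (i n) (j n), memorySeq i j n = some a := by
  rcases n with _ | n
  · exact ⟨_, le_rfl, by simp [memorySeq, pmUpdate, h]⟩
  · rw [memorySeq]
    rcases memorySeq i j n with _ | a
    · exact ⟨_, le_rfl, by simp [pmUpdate, h]⟩
    · exact ⟨min (min (i (n + 1)) (j (n + 1))) a, min_le_left _ _, by rw [pmUpdate_some, if_pos h]⟩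

theorem memorySeq_succ_cases {i j : ℕ → ℕ} {n a : ℕ} (h : memorySeq i j n = some a) :
    (memorySeq i j (n + 1) = none ∧ Even (j (n + 1)) ∧ j (n + 1) ≤ a) ∨
    (∃ a' ≤ a, memorySeq i j (n + 1) = some a' ∧
      (Even (j (n + 1)) → j (n + 1) ≤ a → a' < a)) := by
  rw [memorySeq, h, pmUpdate_some]
  split_ifs with h₁ h₂
  -- If `i ≺ j` with `j` even, then `i < j`, so the new minimum lies strictly below `a`.
  · refine .inr ⟨_, min_le_right _ _, rfl, fun hev hle => ?_⟩
    rw [rewardLT_iff] at h₁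
    rw [Nat.even_iff, Nat.odd_iff] at *
    omega
  · exact .inl ⟨rfl, h₂⟩
  · exact .inr ⟨a, le_rfl, rfl, fun hev hle => absurd ⟨hev, hle⟩ h₂⟩

theorem exists_even_le_of_memorySeq_eq_none {i j : ℕ → ℕ} (l : ℕ) :
    ∀ n a, memorySeq i j n = some a → memorySeq i j (n + l) = none →
      ∃ n' > n, Even (j n') ∧ j n' ≤ a := by
  induction l with
  | zero => intro n a h h'; simp [h] at h'
  | succ l ih =>
    intro n a h h'
    rcases memorySeq_succ_cases h with ⟨-, hev, hle⟩ | ⟨a', ha', hs, -⟩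
    · exact ⟨n + 1, n.lt_succ_self, hev, hle⟩
    · obtain ⟨n', hn', hev, hle⟩ := ih (n + 1) a' hs (by rw [← h']; congr 1; omega)
      exact ⟨n', by omega, hev, hle.trans ha'⟩

/-- A freshly written value is repaid by `exists_repay`. An unchanged value inherits the earlier
witness, which cannot be the current step: an even `j` at most the content would have lowered or
cleared it. -/
theorem Dominates.exists_even_le_memorySeq {i j : ℕ → ℕ} (h : Dominates i j) (n : ℕ) :
    ∀ a, memorySeq i j n = some a → ∃ n' > n, Even (j n') ∧ j n' ≤ a := by
  induction n with
  | zero =>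
    intro a ha
    by_cases hlt : RewardLT (i 0) (j 0)
    · simp only [memorySeq, pmUpdate, hlt, if_true, Option.some.injEq] at ha
      exact ha ▸ h.exists_repay hlt
    · simp [memorySeq, pmUpdate, hlt] at ha
  | succ n ih =>
    intro a ha
    rcases hprev : memorySeq i j n with _ | b
    · by_cases hlt : RewardLT (i (n + 1)) (j (n + 1))
      · simp only [memorySeq, hprev, pmUpdate, hlt, if_true, Option.some.injEq] at ha
        exact ha ▸ h.exists_repay hlt
      · simp [memorySeq, hprev, pmUpdate, hlt] at ha
    · obtain ⟨n', hn', hev, hle⟩ := ih b hprev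
      rcases memorySeq_succ_cases hprev with ⟨hnone, -⟩ | ⟨a', ha', hs, himp⟩
      · simp [hnone] at ha
      · obtain rfl : a' = a := by simpa [hs] using ha
        rcases ha'.eq_or_lt with rfl | hlt'
        · refine ⟨n', lt_of_le_of_ne hn' ?_, hev, hle⟩
          rintro rfl
          exact lt_irrefl _ (himp hev hle)
        · rw [memorySeq, hprev, pmUpdate_some] at hs
          split_ifs at hs with hlt
          · obtain ⟨n'', hn'', hev', hle'⟩ := h.exists_repay hlt
            refine ⟨n'', hn'', hev', ?_⟩
            have := Option.some.inj hs
            omega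
          · have := Option.some.inj hs
            omega

/-- Without ✓ the content can only shrink. A drop is handled by induction on the content, and a
constant content is refuted by the next even `j` below or equal to it. -/
theorem Dominates.exists_memorySeq_eq_none {i j : ℕ → ℕ} (h : Dominates i j) (a : ℕ) :
    ∀ n, memorySeq i j n = some a → ∃ n' > n, memorySeq i j n' = none := by
  induction a using Nat.strong_induction_on with
  | _ a ih =>
    intro n ha
    obtain ⟨n', hn', hev, hle⟩ := h.exists_even_le_memorySeq n a ha
    by_contra! hne
    have hconst : ∀ l, memorySeq i j (n + l) = some a := by
      intro l
      induction l with
      | zero => exact ha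
      | succ l ihl =>
        rcases memorySeq_succ_cases ihl with ⟨hnone, -⟩ | ⟨a', ha', hs, -⟩
        · exact absurd hnone (hne _ (by omega))
        · rcases ha'.eq_or_lt with rfl | hlt
          · exact hs
          · obtain ⟨b, hb, hnone⟩ := ih a' hlt _ hs
            exact absurd hnone (hne b (by omega))
    obtain ⟨l, rfl⟩ : ∃ l, n' = n + l + 1 := ⟨n' - n - 1, by omega⟩
    rcases memorySeq_succ_cases (hconst l) with ⟨hnone, -⟩ | ⟨a', -, hs, himp⟩
    · exact hne _ hn' hnone
    · have : a' = a := by simpa [show n + l + 1 = n + (l + 1) by omega, hconst (l + 1)] using hs.symm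
      have := himp hev hle
      omega

/-- Duplicator's winning condition, without reference to the priority memory. -/
theorem frequently_memorySeq_eq_none_iff (i j : ℕ → ℕ) :
    (∃ᶠ n in atTop, memorySeq i j n = none) ↔ Dominates i j := by
  rw [frequently_atTop]
  constructor
  · intro h
    have key : ∀ n, RewardLT (i n) (j n) → ∃ n' > n, Even (j n') ∧ j n' ≤ min (i n) (j n) := by
      intro n hlt
      obtain ⟨a, ha, hs⟩ := memorySeq_eq_some_of_rewardLT hlt
      obtain ⟨b, hb, hnone⟩ := h n
      obtain ⟨l, rfl⟩ := Nat.exists_eq_add_of_le hb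
      obtain ⟨n', hn', hev, hle⟩ := exists_even_le_of_memorySeq_eq_none l n a hs hnone
      exact ⟨n', hn', hev, hle.trans ha⟩
    refine ⟨fun n hn => ?_, fun n hn hlt => ?_⟩
    · by_cases hlt : RewardLT (i n) (j n)
      · obtain ⟨n', hn', hev, hle⟩ := key n hlt
        exact ⟨n', hn'.le, hev, hle.trans (min_le_left _ _)⟩
      · refine ⟨n, le_rfl, ?_⟩
        rw [rewardLT_iff] at hlt
        rw [Nat.even_iff, Nat.odd_iff] at *
        omega
    · obtain ⟨n', hn', hev, hle⟩ := key n ((rewardLT_iff _ _).2 (.inr ⟨hn, hlt⟩))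
      refine ⟨n', hn'.le, hev, lt_of_le_of_ne (hle.trans (min_le_right _ _)) fun he => ?_⟩
      rw [he] at hev
      exact Nat.not_even_iff_odd.2 hn hev
  · intro h n
    rcases hs : memorySeq i j n with _ | a
    · exact ⟨n, le_rfl, hs⟩
    · obtain ⟨n', hn', hnone⟩ := h.exists_memorySeq_eq_none a n hs
      exact ⟨n', hn'.le, hnone⟩

namespace ColouredAutomaton

variable {S V : Type*}

/-! ### Right-hand delayed simulation in terms of paths -/

/-- An infinite path through the states in `S × V`. -/
def IsPath (A : ColouredAutomaton S V) (P : ℕ → S × V) : Prop :=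
  ∀ n, A.step (.pair (P n).1 (P n).2) (P (n + 1)).2 = .pair (P (n + 1)).1 (P (n + 1)).2

theorem rhLE_iff {A : ColouredAutomaton S V} {p q : S × V} : A.RhLE p q ↔
    ∀ P Q : ℕ → S × V, A.IsPath P → A.IsPath Q → P 0 = p → Q 0 = q →
      (∀ n, (P (n + 1)).2 = (Q (n + 1)).2) →
      Dominates (fun n => A.pairColour (P n)) fun n => A.pairColour (Q n) := by
  constructor
  -- Player 0 owns no position, so every play conforms to `f`, whatever `f` is.
  · rintro ⟨f, -, hf⟩ P Q hP hQ rfl rfl hPQ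
    rw [← frequently_memorySeq_eq_none_iff]
    exact hf (fun n => (P n, Q n,
      memorySeq (fun n => A.pairColour (P n)) (fun n => A.pairColour (Q n)) n))
      (fun n => ⟨hP n, hQ n, hPQ n, rfl⟩) rfl fun n hn => hn.elim
  · intro h
    refine ⟨fun _ => A.simInit p q, fun _ _ _ hv => hv.elim, fun ρ hρ h0 _ => ?_⟩
    have hdom := h (fun n => (ρ n).1) (fun n => (ρ n).2.1) (fun n => (hρ n).1)
      (fun n => (hρ n).2.1) (by simp [h0, simInit]) (by simp [h0, simInit])
      (fun n => (hρ n).2.2.1)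
    rw [← frequently_memorySeq_eq_none_iff] at hdom
    refine hdom.mono fun n hn => ?_
    rw [← hn]
    clear hn
    induction n with
    -- The initial memory content is the update of ✓ by the initial colours.
    | zero => simp only [memorySeq, h0]; rfl
    | succ n ih => rw [(hρ n).2.2.2, ih, memorySeq]

/-- The structural properties of game automata: `q₀` leads to a fixed memory content, the sink is
absorbing, and whether a letter leads from `(s, v)` to the sink does not depend on `s`. -/
structure IsGameLike (A : ColouredAutomaton S V) : Prop where
  step_init : ∃ s₀, ∀ v, A.step .init v = .pair s₀ v
  step_sink : ∀ v, A.step .sink v = .sink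
  step_pair : ∀ v v', (∀ s, ∃ s', A.step (.pair s v) v' = .pair s' v') ∨
    ∀ s, A.step (.pair s v) v' = .sink

namespace IsGameLike

variable {A : ColouredAutomaton S V}

theorem exists_succ (hA : A.IsGameLike) {s s' : S} {v v' : V}
    (h : A.step (.pair s v) v' = .pair s' v') (t : S) :
    ∃ t', A.step (.pair t v) v' = .pair t' v' := by
  rcases hA.step_pair v v' with h' | h'
  · exact h' t
  · simp [h' s] at h

/-- Whether a letter can be read depends only on the `V`-component, so every memory content can
follow the letters of `P`. -/
theorem exists_path (hA : A.IsGameLike) {P : ℕ → S × V} (hP : A.IsPath P) (t : S) :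
    ∃ Q : ℕ → S × V, A.IsPath Q ∧ Q 0 = (t, (P 0).2) ∧ ∀ n, (Q n).2 = (P n).2 := by
  have hs : ∀ n t, ∃ t', A.step (.pair t (P n).2) (P (n + 1)).2 = .pair t' (P (n + 1)).2 :=
    fun n t => hA.exists_succ (hP n) t
  choose g hg using hs
  exact ⟨fun n => (Nat.rec t (fun n s => g n s) n, (P n).2), fun n => hg n _, rfl, fun _ => rfl⟩

end IsGameLike

theorem IsPath.ext {A : ColouredAutomaton S V} {P Q : ℕ → S × V} (hP : A.IsPath P)
    (hQ : A.IsPath Q) (h0 : P 0 = Q 0) (h : ∀ n, (P (n + 1)).2 = (Q (n + 1)).2) : P = Q := by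
  funext n
  induction n with
  | zero => exact h0
  | succ n ih =>
    have h₁ := hP n
    rw [ih, h n, hQ n] at h₁
    exact Prod.ext (AutState.pair.inj h₁).1.symm (h n)

theorem RhEquiv.refl (A : ColouredAutomaton S V) (p : S × V) : A.RhEquiv p p := by
  have : A.RhLE p p := rhLE_iff.2 fun P Q hP hQ h₁ h₂ h => by
    rw [hP.ext hQ (h₁.trans h₂.symm) h]
    exact Dominates.refl _
  exact ⟨rfl, this, this⟩

theorem RhEquiv.symm {A : ColouredAutomaton S V} {p q : S × V} (h : A.RhEquiv p q) :
    A.RhEquiv q p := ⟨h.1.symm, h.2.2, h.2.1⟩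

theorem RhLE.trans {A : ColouredAutomaton S V} (hA : A.IsGameLike) {p q r : S × V}
    (hpq : p.2 = q.2) (h₁ : A.RhLE p q) (h₂ : A.RhLE q r) : A.RhLE p r := by
  rw [rhLE_iff] at *
  intro P R hP hR hp hr hPR
  obtain ⟨Q, hQ, hq, hQP⟩ := hA.exists_path hP q.1
  have hq' : Q 0 = q := by rw [hq, hp, hpq]
  exact (h₁ P Q hP hQ hp hq' fun n => (hQP _).symm).trans
    (h₂ Q R hQ hR hq' hr fun n => (hQP _).trans (hPR n))

theorem RhEquiv.trans {A : ColouredAutomaton S V} (hA : A.IsGameLike) {p q r : S × V}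
    (h₁ : A.RhEquiv p q) (h₂ : A.RhEquiv q r) : A.RhEquiv p r :=
  ⟨h₁.1.trans h₂.1, h₁.2.1.trans hA h₁.1 h₂.2.1, h₂.2.2.trans hA h₂.1.symm h₁.2.2⟩

/-- Prepend `p` and `q` to the given paths, then discard the first colour: `Dominates` only looks
forward. -/
theorem RhLE.step {A : ColouredAutomaton S V} {p q p' q' : S × V} (h : A.RhLE p q)
    (hp : A.step (.pair p.1 p.2) p'.2 = .pair p'.1 p'.2)
    (hq : A.step (.pair q.1 q.2) q'.2 = .pair q'.1 q'.2) (hpq : p'.2 = q'.2) :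
    A.RhLE p' q' := by
  rw [rhLE_iff] at *
  rintro P Q hP hQ rfl rfl hPQ
  exact (h (fun n => n.casesOn p P) (fun n => n.casesOn q Q)
    (fun n => n.casesOn hp hP) (fun n => n.casesOn hq hQ) rfl rfl
    (fun n => n.casesOn hpq hPQ)).tail

theorem RhEquiv.step {A : ColouredAutomaton S V} {p q p' q' : S × V} (h : A.RhEquiv p q)
    (hp : A.step (.pair p.1 p.2) p'.2 = .pair p'.1 p'.2)
    (hq : A.step (.pair q.1 q.2) q'.2 = .pair q'.1 q'.2) (hpq : p'.2 = q'.2) :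
    A.RhEquiv p' q' :=
  ⟨hpq, h.2.1.step hp hq hpq, h.2.2.step hq hp hpq.symm⟩

/-! ### The quotient automaton -/

/-- `Quot` identifies along the generated equivalence, so transitivity of `MemEquiv` is what
matters; it needs the intermediate paths that `IsGameLike` supplies. -/
theorem memEquiv_of_memClass_eq {A : ColouredAutomaton S V} (hA : A.IsGameLike) {s t : S}
    (h : A.memClass s = A.memClass t) : A.MemEquiv s t := by
  have hE : Equivalence A.MemEquiv :=
    ⟨fun s v => RhEquiv.refl A (s, v), fun h v => (h v).symm, fun h h' v => (h v).trans hA (h' v)⟩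
  exact hE.eqvGen_iff.1 (Quot.eqvGen_exact h)

/-- The minimal colour in the class of `p`. -/
noncomputable def classColour (A : ColouredAutomaton S V) (p : S × V) : ℕ :=
  sInf {c | ∃ q, A.RhEquiv q p ∧ c = A.pairColour q}

theorem classColour_le {A : ColouredAutomaton S V} {p q : S × V} (h : A.RhEquiv q p) :
    A.classColour p ≤ A.pairColour q := Nat.sInf_le ⟨q, h, rfl⟩

theorem exists_pairColour_eq_classColour (A : ColouredAutomaton S V) (p : S × V) :
    ∃ q, A.RhEquiv q p ∧ A.classColour p = A.pairColour q :=
  Nat.sInf_mem (s := {c | ∃ q, A.RhEquiv q p ∧ c = A.pairColour q})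
    ⟨_, p, RhEquiv.refl A p, rfl⟩

theorem quotColour_pair {A : ColouredAutomaton S V} (hA : A.IsGameLike) {s t : S} {v : V}
    (h : A.RhEquiv (s, v) (t, v)) :
    A.quotColour (.pair (A.memClass t) v) = A.classColour (s, v) := by
  change sInf {c | ∃ (u : S) (p : S × V),
    A.memClass u = A.memClass t ∧ A.RhEquiv p (u, v) ∧ c = A.pairColour p} = sInf _
  congr 1
  ext c
  constructor
  · rintro ⟨u, p, hu, hp, rfl⟩
    exact ⟨p, (hp.trans hA (memEquiv_of_memClass_eq hA hu v)).trans hA h.symm, rfl⟩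
  · rintro ⟨q, hq, rfl⟩
    exact ⟨t, q, rfl, hq.trans hA h, rfl⟩

theorem IsPath.rhEquiv {A : ColouredAutomaton S V} {P Q : ℕ → S × V} (hP : A.IsPath P)
    (hQ : A.IsPath Q) (h0 : A.RhEquiv (P 0) (Q 0)) (h : ∀ n, (P n).2 = (Q n).2) (n : ℕ) :
    A.RhEquiv (P n) (Q n) := by
  induction n with
  | zero => exact h0
  | succ n ih => exact ih.step (hP n) (hQ n) (h _)

/-- Along a path, the colours of the states may be replaced by those of their classes. -/
theorem IsPath.minParity_iff {A : ColouredAutomaton S V} (hA : A.IsGameLike) {k : ℕ}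
    (hk : ∀ q, A.colour q ≤ k) {P : ℕ → S × V} (hP : A.IsPath P) :
    MinParity (fun n => A.pairColour (P n)) ↔ MinParity fun n => A.classColour (P n) := by
  have key : ∀ n, ∃ Q : ℕ → S × V, A.classColour (P n) = A.pairColour (Q 0) ∧
      (∀ l, A.RhEquiv (Q l) (P (n + l))) ∧
      Dominates (fun l => A.pairColour (P (n + l))) (fun l => A.pairColour (Q l)) ∧
      Dominates (fun l => A.pairColour (Q l)) (fun l => A.pairColour (P (n + l))) := by
    intro n
    obtain ⟨q, hq, hc⟩ := A.exists_pairColour_eq_classColour (P n)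
    have hPn : A.IsPath fun l => P (n + l) := fun l => hP (n + l)
    obtain ⟨Q, hQ, hQ0, hQP⟩ := hA.exists_path hPn q.1
    obtain rfl : Q 0 = q := by rw [hQ0]; exact Prod.ext rfl hq.1.symm
    exact ⟨Q, hc, hQ.rhEquiv hPn hq hQP,
      rhLE_iff.1 hq.2.2 _ _ hPn hQ rfl rfl fun l => (hQP _).symm,
      rhLE_iff.1 hq.2.1 _ _ hQ hPn rfl rfl fun l => hQP _⟩
  refine minParity_iff_of_lowered (k := k) (fun n => hk _)
    (fun n => classColour_le (RhEquiv.refl A _)) (fun n hodd hlt => ?_) fun n hev => ?_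
  · obtain ⟨Q, hc, hequiv, hdom, -⟩ := key n
    rw [hc] at hodd hlt ⊢
    obtain ⟨l, -, -, hl⟩ := hdom.2 0 hodd hlt
    exact ⟨n + l, by omega, (classColour_le (hequiv l)).trans_lt hl⟩
  · obtain ⟨Q, hc, -, -, hdom⟩ := key n
    rw [hc] at hev ⊢
    obtain ⟨l, -, -, hl⟩ := hdom.1 0 hev
    exact ⟨n + l, by omega, hl⟩

/-- Correspondence between states of the automaton and of its quotient. -/
inductive QuotRel (A : ColouredAutomaton S V) : AutState S V → AutState A.MemQuot V → Prop
  | init : QuotRel A .init .init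
  | sink : QuotRel A .sink .sink
  | pair {s t : S} {v : V} (h : A.RhEquiv (s, v) (t, v)) :
      QuotRel A (.pair s v) (.pair (A.memClass t) v)

/-- The choice of the least successor is harmless: successors of equivalent states under one letter
are equivalent. -/
theorem QuotRel.step [LinearOrder S] [Finite S] {A : ColouredAutomaton S V} (hA : A.IsGameLike)
    {x : AutState S V} {y : AutState A.MemQuot V} (h : A.QuotRel x y) (v' : V) :
    A.QuotRel (A.step x v') (A.quotStep y v') := by
  cases h with
  | init =>
    obtain ⟨s₀, hs₀⟩ := hA.step_init
    simp only [quotStep, hs₀]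
    exact .pair (RhEquiv.refl A _)
  | sink =>
    simp only [quotStep, hA.step_sink]
    exact .sink
  | @pair s t v h =>
    rcases hA.step_pair v v' with hv | hv
    · have hne : (A.succMemory (A.memClass t) v v').Nonempty := (hv t).imp fun t' ht => ⟨t, rfl, ht⟩
      obtain ⟨s', hs'⟩ := hv s
      obtain ⟨u, hu, hu'⟩ := wellFounded_lt.min_mem (A.succMemory (A.memClass t) v v') hne
      rw [quotStep, dif_pos hne, hs']
      exact .pair ((h.trans hA (memEquiv_of_memClass_eq hA hu.symm v)).step
        (p' := (s', v')) hs' hu' rfl)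
    · have hne : ¬(A.succMemory (A.memClass t) v v').Nonempty := by
        rintro ⟨u', u, -, hu⟩
        simp [hv u] at hu
      rw [quotStep, dif_neg hne, hv s]
      exact .sink

theorem quotRel_run [LinearOrder S] [Finite S] {A : ColouredAutomaton S V} (hA : A.IsGameLike)
    (α : ℕ → V) (n : ℕ) : A.QuotRel (A.run α n) (A.quotient.run α n) := by
  induction n with
  | zero => exact .init
  | succ n ih => exact ih.step hA (α n)

theorem IsGameLike.run_eq_sink {A : ColouredAutomaton S V} (hA : A.IsGameLike) {α : ℕ → V} {n m : ℕ}
    (h : A.run α n = .sink) (hnm : n ≤ m) : A.run α m = .sink := by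
  induction m, hnm using Nat.le_induction with
  | base => exact h
  | succ m _ ih => rw [run, ih, hA.step_sink]

theorem IsGameLike.exists_pair_of_run_ne_sink {A : ColouredAutomaton S V} (hA : A.IsGameLike)
    {α : ℕ → V} (h : ∀ n, A.run α n ≠ .sink) (n : ℕ) :
    ∃ s, A.run α (n + 1) = .pair s (α n) := by
  induction n with
  | zero =>
    obtain ⟨s₀, hs₀⟩ := hA.step_init
    exact ⟨s₀, hs₀ _⟩
  | succ n ih =>
    obtain ⟨s, hs⟩ := ih
    have hne := h (n + 1 + 1)
    rw [run, hs] at hne ⊢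
    rcases hA.step_pair (α n) (α (n + 1)) with hv | hv
    · exact hv s
    · exact absurd (hv s) hne

/-- The quotient by right-hand delayed simulation preserves the language. -/
theorem IsGameLike.minLanguage_quotient [LinearOrder S] [Finite S] {A : ColouredAutomaton S V}
    (hA : A.IsGameLike) {k : ℕ} (hk : ∀ q, A.colour q ≤ k) :
    A.minLanguage = A.quotient.minLanguage := by
  ext α
  change MinParity (fun n => A.colour (A.run α n)) ↔
    MinParity fun n => A.quotColour (A.quotient.run α n)
  by_cases hsink : ∃ n, A.run α n = .sink
  · obtain ⟨n, hn⟩ := hsink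
    -- Once in the sink, both runs stay there and show the same colour.
    refine minParity_congr (eventually_atTop.2 ⟨n, fun m hm => ?_⟩)
    have hrel := quotRel_run hA α m
    simp only [hA.run_eq_sink hn hm] at hrel ⊢
    generalize A.quotient.run α m = y at hrel
    cases hrel
    rfl
  · push Not at hsink
    choose g hg using hA.exists_pair_of_run_ne_sink hsink
    have hP : A.IsPath fun n => (g n, α n) := fun n => by
      change A.step (.pair (g n) (α n)) (α (n + 1)) = .pair (g (n + 1)) (α (n + 1))
      rw [← hg n, ← hg (n + 1)]; rfl
    have hcol : ∀ n, A.quotColour (A.quotient.run α (n + 1)) = A.classColour (g n, α n) := by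
      intro n
      have hrel := quotRel_run hA α (n + 1)
      rw [hg n] at hrel
      generalize A.quotient.run α (n + 1) = y at hrel
      cases hrel with
      | pair h => exact quotColour_pair hA h
    -- Drop `q₀`, the only state of the run outside `S × V`.
    rw [← minParity_shift, ← minParity_shift fun n => A.quotColour (A.quotient.run α n)]
    simp only [hg, hcol]
    exact hP.minParity_iff hA hk

/-! ### Recolouring -/

theorem run_recolour (A : ColouredAutomaton S V) (k : ℕ) (α : ℕ → V) (n : ℕ) :
    (A.recolour k).run α n = A.run α n := by
  induction n with
  | zero => rfl
  | succ n ih => rw [run, run, ih]; rfl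

theorem maxLanguage_eq_minLanguage_recolour (A : ColouredAutomaton S V) {k : ℕ} (hk : Even k)
    (hbound : ∀ q, A.colour q ≤ k) : A.maxLanguage = (A.recolour k).minLanguage := by
  ext α
  change MaxParity _ ↔ MinParity fun n => k - A.colour ((A.recolour k).run α n)
  simp only [run_recolour]
  exact maxParity_iff_minParity_sub hk fun n => hbound _

end ColouredAutomaton

/-- The game automaton of a simulating game satisfies the structural properties. -/
theorem InfiniteGame.SimulatedBy.isGameLike {V S : Type*} {Γ : InfiniteGame V}
    {Γ' : ParityGame (S × V)} {s₀ : S} (hsim : Γ.SimulatedBy Γ'.toInfiniteGame s₀)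
    (c₀ cs k : ℕ) : ((gameAutomaton Γ.toArena Γ' s₀ c₀ cs).recolour k).IsGameLike where
  step_init := ⟨s₀, fun _ => rfl⟩
  step_sink _ := rfl
  step_pair v v' := by
    change (∀ s, ∃ s', gameStep Γ'.edge s₀ (.pair s v) v' = .pair s' v') ∨
      ∀ s, gameStep Γ'.edge s₀ (.pair s v) v' = .sink
    by_cases h : Γ.edge v v'
    · refine .inl fun s => ?_
      have hs : ∃ s', Γ'.edge (s, v) (s', v') := hsim.exists_edge s v v' h
      rw [gameStep, dif_pos hs]
      exact ⟨_, rfl⟩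
    · refine .inr fun s => ?_
      have hs : ¬∃ s', Γ'.edge (s, v) (s', v') := fun ⟨s', hs'⟩ => h (hsim.edge_proj s v s' v' hs')
      rw [gameStep, dif_neg hs]

end GameReduction

theorem mainTheorem6 {V S : Type*} [Finite V] [Finite S] [LinearOrder S]
    (Γ : GameReduction.InfiniteGame V) (Γ' : GameReduction.ParityGame (S × V)) (s₀ : S)
    (hsim : Γ.SimulatedBy Γ'.toInfiniteGame s₀) (c₀ cs k : ℕ) (hk : Even k)
    (hbound : ∀ q, (GameReduction.gameAutomaton Γ.toArena Γ' s₀ c₀ cs).colour q ≤ k) :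
    let A := GameReduction.gameAutomaton Γ.toArena Γ' s₀ c₀ cs
    A.maxLanguage = (A.recolour k).minLanguage ∧
      (A.recolour k).minLanguage = (A.recolour k).quotient.minLanguage := by
  intro A
  exact ⟨A.maxLanguage_eq_minLanguage_recolour hk hbound,
    (hsim.isGameLike c₀ cs k).minLanguage_quotient fun _ => Nat.sub_le _ _⟩
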